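/- **Notation.** For $n\ge 1$ let $\mathcal A_n=\{1<2<\dots<n\}$. For a word $w\in\mathcal A_n^\star$, let $P_{\mathsf{sylv}}(w)$ be the binary tree obtained by reading $w$ from right to left and inserting each letter $a$ into an initially empty binary search tree, going at a node labelled $x$ to the right subtree if $a>x$ and to the left subtree otherwise. Let $P_{\mathsf{sylv}^\sharp}(w)$ be the tree obtained by reading $w$ from left to right and inserting each letter $a$, going at a node labelled $x$ to the left subtree if $a<x$ and to the right subtree otherwise. The Baxter monoid $\mathsf{baxt}_n$ is the quotient of $\mathcal A_n^\star$ by the congruence $u\equiv v \iff (P_{\mathsf{sylv}^\sharp}(u),P_{\mathsf{sylv}}(u))=(P_{\mathsf{sylv}^\sharp}(v),P_{\mathsf{sylv}}(v))$; $[w]$ is the class of $w$. Its involution is $[w_1\cdots w_k]^\sharp=[w_k^\sharp\cdots w_1^\sharp]$, where $a^\sharp=n+1-a$. On $\mathsf{baxt}_3\times\mathsf{baxt}_3$ put $(x,y)^\sharp=(y^\sharp,x^\sharp)$, and let products of copies of it carry the componentwise involution. For an $N\times N$ matrix $A$ let $A^D$ be its skew transpose, $(A^D)_{ij}=A_{(N+1-j)(N+1-i)}$,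 and let $UT_N(\mathbb S)$ be the monoid of upper triangular $N\times N$ matrices over $\mathbb S$. For $a,b\in\mathcal A_3$ and $p<q$ in $\mathcal A_n$ let $\sigma^{a,b}_{p,q}:\mathcal A_n\to\mathsf{baxt}_3$ send $p\mapsto[a]$, $q\mapsto[b]$, $k\mapsto[ba]$ for $p<k<q$, and every other letter to $[\varepsilon]$. For $1\le i<j\le n$ let $\varphi_{ij}:\mathcal A_n\to\mathsf{baxt}_3\times\mathsf{baxt}_3$ be $$\varphi_{ij}=\begin{cases}(\sigma^{1,3}_{i,j},\ \sigma^{1,3}_{i,j}) & \text{if } i^\sharp=j,\\ (\sigma^{1,2}_{i,j},\ \sigma^{2,3}_{j^\sharp,i^\sharp}) & \text{if } j<i^\sharp,\\ (\sigma^{1,2}_{j^\sharp,i^\sharp},\ \sigma^{2,3}_{i,j}) & \text{if } i^\sharp<j.\end{cases}$$ Let $I_n=\{(i,j):1\le i<j\le n\}$, so $|I_n|=\binom n2$. For an element $s$ of a semiring put $$P=\begin{pmatrix}s&0\\0&1\end{pmatrix},\quad Q=\begin{pmatrix}1&0\\0&s\end{pmatrix},\quad J=\begin{pmatrix}1&1\\0&0\end{pmatrix},\quad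 K=\begin{pmatrix}0&1\\0&1\end{pmatrix},\quad E=\begin{pmatrix}1&0\\0&1\end{pmatrix}.$$ **Theorem.** Let $n\ge4$, let $\mathbb S$ be a commutative semiring with $0$ and $1$ that is idempotent ($a+a=a$ for all $a$), let $s\in\mathbb S$ have infinite multiplicative order (for all integers $i,j\ge 0$, $s^i=s^j$ iff $i=j$), and fix any enumeration $e_1,\dots,e_m$ of $I_n$, where $m=\binom n2$. 1. The letter maps $\varphi_{ij}$ induce an injective monoid homomorphism $\phi_n:\mathsf{baxt}_n\to\prod_{(i,j)\in I_n}(\mathsf{baxt}_3\times\mathsf{baxt}_3)$, with $(i,j)$-component extending $\varphi_{ij}$, and $\phi_n(x^\sharp)=\phi_n(x)^\sharp$ for all $x$. 2. The assignment $$\begin{aligned}1&\mapsto\mathrm{diag}\{s,P,P,E,1,J,E,J,1\},\\ 2&\mapsto\mathrm{diag}\{1,K,K,P,s,Q,J,J,1\},\\ 3&\mapsto\mathrm{diag}\{1,K,E,K,1,E,Q,Q,s\}\end{aligned}$$ (block diagonal matrices) induces an injective monoid homomorphism $\varphi_3:\mathsf{baxt}_3\to UT_{15}(\mathbb S)$ with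 $\varphi_3(x^\sharp)=\varphi_3(x)^D$ for all $x$. 3. Writing $\phi_n(x)_{e_t}=(x_t,y_t)$ for $1\le t\le m$, the map $$\varphi_n(x)=\mathrm{diag}\{\varphi_3(x_1),\dots,\varphi_3(x_m),\varphi_3(y_m),\dots,\varphi_3(y_1)\}$$ is an injective monoid homomorphism $\varphi_n:\mathsf{baxt}_n\to UT_{30\binom n2}(\mathbb S)$ with $\varphi_n(x^\sharp)=\varphi_n(x)^D$ for all $x$. That is, $\varphi_n$ is a faithful representation of $(\mathsf{baxt}_n,{}^\sharp)$ in $(UT_{30\binom n2}(\mathbb S),{}^D)$. In particular this applies to the tropical semiring $(\mathbb R\cup\{-\infty\},\max,+)$: it is idempotent, and each of its elements other than $-\infty$ (its zero) and $0$ (its one) has infinite multiplicative order. -/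

import Mathlib

/-! ## Binary search trees and the two insertion algorithms -/

namespace Baxter

section Mirror

variable {α β : Type*}

/-- Reflect a tree and relabel it (auxiliary). -/
def mirror (f : α → β) : BinaryTree α → BinaryTree β
  | .nil => .nil
  | .node x l r => .node (f x) (mirror f r) (mirror f l)

theorem mirror_injective (f : α → β) (hf : Function.Injective f) :
    Function.Injective (mirror f) := by
  intro s
  induction s with
  | nil => intro t h; cases t <;> simp_all [mirror]
  | node x l r ihl ihr =>
    intro t h
    cases t with
    | nil => simp [mirror] at h
    | node y l' r' =>
      simp only [mirror, BinaryTree.node.injEq] at h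
      rw [hf h.1, ihl h.2.2, ihr h.2.1]

end Mirror

section Trees

variable {α β : Type*} [LinearOrder α] [LinearOrder β]

/-- Insertion of a symbol into a right strict binary search tree: go right if `a > x`,
otherwise go left. -/
def rsInsert (a : α) : BinaryTree α → BinaryTree α
  | .nil => .node a .nil .nil
  | .node x l r => if x < a then .node x l (rsInsert a r) else .node x (rsInsert a l) r

/-- Insertion of a symbol into a left strict binary search tree: go left if `a < x`,
otherwise go right. -/
def lsInsert (a : α) : BinaryTree α → BinaryTree α
  | .nil => .node a .nil .nil
  | .node x l r => if a < x then .node x (lsInsert a l) r else .node x l (lsInsert a r)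

/-- The right strict binary search tree of a word, read from right to left. -/
def rsTree (w : List α) : BinaryTree α := w.foldr rsInsert .nil

/-- The left strict binary search tree of a word, read from left to right. -/
def lsTree (w : List α) : BinaryTree α := w.foldl (fun t a => lsInsert a t) .nil

/-- The pair of binary search trees attached to a word. -/
def baxterTrees (w : List α) : BinaryTree α × BinaryTree α := (lsTree w, rsTree w)

/-! ### Auxiliary facts: equality of the trees is a congruence -/

/-- The part of a tree with labels at most `x` (auxiliary). -/
def lowPart (x : α) : BinaryTree α → BinaryTree α
  | .nil => .nil
  | .node y l r => if y ≤ x then .node y l (lowPart x r) else lowPart x l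

/-- The part of a tree with labels larger than `x` (auxiliary). -/
def highPart (x : α) : BinaryTree α → BinaryTree α
  | .nil => .nil
  | .node y l r => if x < y then .node y (highPart x l) r else highPart x r

theorem lowPart_rsInsert (x a : α) (t : BinaryTree α) :
    lowPart x (rsInsert a t) = if a ≤ x then rsInsert a (lowPart x t) else lowPart x t := by
  induction t with
  | nil => by_cases h : a ≤ x <;> simp [rsInsert, lowPart, h]
  | node y l r ihl ihr =>
    by_cases hy : y ≤ x
    · by_cases ha : y < a
      · by_cases hax : a ≤ x <;> simp [rsInsert, lowPart, hy, ha, ihr, hax]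
      · have hax : a ≤ x := (not_lt.mp ha).trans hy
        simp [rsInsert, lowPart, hy, ha, hax]
    · by_cases ha : y < a
      · have hax : ¬ a ≤ x := not_le.mpr ((not_le.mp hy).trans ha)
        simp [rsInsert, lowPart, hy, ha, hax]
      · simp [rsInsert, lowPart, hy, ha, ihl]

theorem highPart_rsInsert (x a : α) (t : BinaryTree α) :
    highPart x (rsInsert a t) = if x < a then rsInsert a (highPart x t) else highPart x t := by
  induction t with
  | nil => by_cases h : x < a <;> simp [rsInsert, highPart, h]
  | node y l r ihl ihr =>
    by_cases hy : x < y
    · by_cases ha : y < a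
      · have hax : x < a := hy.trans ha
        simp [rsInsert, highPart, hy, ha, hax]
      · by_cases hax : x < a <;> simp [rsInsert, highPart, hy, ha, ihl, hax]
    · by_cases ha : y < a
      · simp [rsInsert, highPart, hy, ha, ihr]
      · have hax : ¬ x < a := not_lt.mpr ((not_lt.mp ha).trans (not_lt.mp hy))
        simp [rsInsert, highPart, hy, ha, hax]

theorem lowPart_rsTree (x : α) (w : List α) :
    lowPart x (rsTree w) = rsTree (w.filter (fun a => a ≤ x)) := by
  induction w with
  | nil => rfl
  | cons a w ih =>
    have h : rsTree (a :: w) = rsInsert a (rsTree w) := rfl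
    rw [h, lowPart_rsInsert, ih]
    by_cases hax : a ≤ x <;> simp [hax, rsTree]

theorem highPart_rsTree (x : α) (w : List α) :
    highPart x (rsTree w) = rsTree (w.filter (fun a => x < a)) := by
  induction w with
  | nil => rfl
  | cons a w ih =>
    have h : rsTree (a :: w) = rsInsert a (rsTree w) := rfl
    rw [h, highPart_rsInsert, ih]
    by_cases hax : x < a <;> simp [hax, rsTree]

theorem foldr_rsInsert_node (x : α) (l r : BinaryTree α) (w : List α) :
    w.foldr rsInsert (.node x l r) =
      .node x ((w.filter (fun a => a ≤ x)).foldr rsInsert l)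
        ((w.filter (fun a => x < a)).foldr rsInsert r) := by
  induction w with
  | nil => rfl
  | cons a w ih =>
    by_cases hax : x < a
    · have h' : ¬ a ≤ x := not_le.mpr hax
      simp [ih, rsInsert, hax, h']
    · have h' : a ≤ x := not_lt.mp hax
      simp [ih, rsInsert, hax, h']

theorem foldr_rsInsert_congr (t : BinaryTree α) :
    ∀ u v : List α, rsTree u = rsTree v → u.foldr rsInsert t = v.foldr rsInsert t := by
  induction t with
  | nil => exact fun u v h => h
  | node x l r ihl ihr =>
    intro u v h
    rw [foldr_rsInsert_node, foldr_rsInsert_node]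
    rw [ihl _ (v.filter (fun a => a ≤ x)) (by rw [← lowPart_rsTree, h, lowPart_rsTree]),
      ihr _ (v.filter (fun a => x < a)) (by rw [← highPart_rsTree, h, highPart_rsTree])]

theorem rsTree_append_congr {u u' v v' : List α} (hu : rsTree u = rsTree u')
    (hv : rsTree v = rsTree v') : rsTree (u ++ v) = rsTree (u' ++ v') := by
  have key : ∀ a b : List α, rsTree (a ++ b) = a.foldr rsInsert (rsTree b) := by
    intro a b
    simp [rsTree, List.foldr_append]
  rw [key, key, hv]
  exact foldr_rsInsert_congr _ _ _ hu

theorem mirror_lsInsert (f : α → β) (hf : StrictAnti f) (a : α) (t : BinaryTree α) :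
    mirror f (lsInsert a t) = rsInsert (f a) (mirror f t) := by
  induction t with
  | nil => rfl
  | node x l r ihl ihr =>
    by_cases h : a < x
    · simp [lsInsert, mirror, rsInsert, h, hf.lt_iff_gt, ihl]
    · simp [lsInsert, mirror, rsInsert, h, hf.lt_iff_gt, ihr]

theorem mirror_rsInsert (f : α → β) (hf : StrictAnti f) (a : α) (t : BinaryTree α) :
    mirror f (rsInsert a t) = lsInsert (f a) (mirror f t) := by
  induction t with
  | nil => rfl
  | node x l r ihl ihr =>
    by_cases h : x < a
    · simp [lsInsert, mirror, rsInsert, h, hf.lt_iff_gt, ihr]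
    · simp [lsInsert, mirror, rsInsert, h, hf.lt_iff_gt, ihl]

theorem lsTree_append_singleton (w : List α) (a : α) :
    lsTree (w ++ [a]) = lsInsert a (lsTree w) := by
  simp [lsTree]

theorem mirror_lsTree (f : α → β) (hf : StrictAnti f) (w : List α) :
    mirror f (lsTree w) = rsTree (w.map f).reverse := by
  induction w using List.reverseRecOn with
  | nil => rfl
  | append_singleton w a ih =>
    rw [lsTree_append_singleton, mirror_lsInsert f hf, ih]
    simp [rsTree]

theorem mirror_rsTree (f : α → β) (hf : StrictAnti f) (w : List α) :
    mirror f (rsTree w) = lsTree (w.map f).reverse := by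
  induction w with
  | nil => rfl
  | cons a w ih =>
    have h : rsTree (a :: w) = rsInsert a (rsTree w) := rfl
    rw [h, mirror_rsInsert f hf, ih, List.map_cons, List.reverse_cons, lsTree_append_singleton]

theorem lsTree_append_congr {u u' v v' : List α} (hu : lsTree u = lsTree u')
    (hv : lsTree v = lsTree v') : lsTree (u ++ v) = lsTree (u' ++ v') := by
  have hf : StrictAnti (OrderDual.toDual : α → αᵒᵈ) := fun _ _ h => h
  apply mirror_injective OrderDual.toDual hf.injective
  rw [mirror_lsTree _ hf, mirror_lsTree _ hf, List.map_append, List.map_append,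
    List.reverse_append, List.reverse_append]
  apply rsTree_append_congr
  · rw [← mirror_lsTree _ hf, ← mirror_lsTree _ hf, hv]
  · rw [← mirror_lsTree _ hf, ← mirror_lsTree _ hf, hu]

end Trees

/-! ## The Baxter monoid of rank `n` and its involution -/

/-- Two words are congruent if the insertion algorithms give the same pair of trees. -/
def baxtCon (n : ℕ) : Con (FreeMonoid (Fin n)) where
  r u v := baxterTrees u.toList = baxterTrees v.toList
  iseqv := ⟨fun _ => rfl, fun h => h.symm, fun h h' => h.trans h'⟩
  mul' := by
    intro u u' v v' hu hv
    simp only [baxterTrees, Prod.mk.injEq, FreeMonoid.toList_mul] at hu hv ⊢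
    exact ⟨lsTree_append_congr hu.1 hv.1, rsTree_append_congr hu.2 hv.2⟩

/-- The Baxter monoid of rank `n`. The ordered alphabet `{1 < 2 < ⋯ < n}` is `Fin n`, that is,
the letter `k` is represented by `k - 1`. -/
abbrev Baxt (n : ℕ) : Type := (baxtCon n).Quotient

/-- The class of a word. -/
abbrev Baxt.mk {n : ℕ} (w : List (Fin n)) : Baxt n :=
  ((FreeMonoid.ofList w : FreeMonoid (Fin n)) : Baxt n)

/-- The involution on words: reverse the word and apply the order-reversing permutation. -/
def sharpWord {n : ℕ} (w : FreeMonoid (Fin n)) : FreeMonoid (Fin n) :=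
  FreeMonoid.ofList (w.toList.map Fin.rev).reverse

theorem sharpWord_congr {n : ℕ} {u v : FreeMonoid (Fin n)} (h : baxtCon n u v) :
    baxtCon n (sharpWord u) (sharpWord v) := by
  change baxterTrees u.toList = baxterTrees v.toList at h
  change baxterTrees (u.toList.map Fin.rev).reverse = baxterTrees (v.toList.map Fin.rev).reverse
  have hf : StrictAnti (Fin.rev : Fin n → Fin n) := Fin.rev_strictAnti
  simp only [baxterTrees, Prod.mk.injEq] at h ⊢
  rw [← mirror_lsTree _ hf, ← mirror_lsTree _ hf, ← mirror_rsTree _ hf, ← mirror_rsTree _ hf,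
    h.1, h.2]
  exact ⟨rfl, rfl⟩

/-- Schützenberger's involution on the Baxter monoid, written `star`. -/
instance (n : ℕ) : StarMul (Baxt n) where
  star := Quotient.map' sharpWord fun _ _ h => sharpWord_congr h
  star_involutive := by
    intro x
    induction x using Con.induction_on with
    | H w =>
      change ((sharpWord (sharpWord w) : FreeMonoid (Fin n)) : Baxt n) = (w : Baxt n)
      congr 1
      have h : (Fin.rev ∘ Fin.rev : Fin n → Fin n) = id := funext fun i => by simp
      simp [sharpWord, h]
  star_mul := by
    intro x y
    induction x using Con.induction_on with
    | H u =>
      induction y using Con.induction_on with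
      | H v =>
        change ((sharpWord (u * v) : FreeMonoid (Fin n)) : Baxt n) =
          ((sharpWord v * sharpWord u : FreeMonoid (Fin n)) : Baxt n)
        congr 1
        simp [sharpWord]

/-! ## Matrices -/

section Matrices

variable {S : Type*} [CommSemiring S]

/-- Reflection of a matrix in the secondary diagonal: `(A^D)_{ij} = A_{(N+1-j)(N+1-i)}`. -/
def skewTranspose {N : ℕ} (A : Matrix (Fin N) (Fin N) S) : Matrix (Fin N) (Fin N) S :=
  Matrix.of fun i j => A j.rev i.rev

/-- The block diagonal matrix with two diagonal blocks. -/
def dsum {k l : ℕ} (A : Matrix (Fin k) (Fin k) S) (B : Matrix (Fin l) (Fin l) S) :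
    Matrix (Fin (k + l)) (Fin (k + l)) S :=
  Matrix.reindex finSumFinEquiv finSumFinEquiv (Matrix.fromBlocks A 0 0 B)

end Matrices

end Baxter

infixl:65 " ⊕ᵈ " => Baxter.dsum

namespace Baxter

section Construction

variable {S : Type*} [CommSemiring S]

/-- The `1 × 1` matrix with entry `a`. -/
def matC (a : S) : Matrix (Fin 1) (Fin 1) S := !![a]

/-- The matrix `P`. -/
def matP (s : S) : Matrix (Fin 2) (Fin 2) S := !![s, 0; 0, 1]

/-- The matrix `Q`. -/
def matQ (s : S) : Matrix (Fin 2) (Fin 2) S := !![1, 0; 0, s]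

/-- The matrix `J`. -/
def matJ : Matrix (Fin 2) (Fin 2) S := !![1, 1; 0, 0]

/-- The matrix `K`. -/
def matK : Matrix (Fin 2) (Fin 2) S := !![0, 1; 0, 1]

/-- The `2 × 2` identity matrix. -/
def matE : Matrix (Fin 2) (Fin 2) S := 1

/-- The images of the three generators of `Baxt 3` in the upper triangular `15 × 15` matrices. -/
def baxt3Matrix (s : S) : Fin 3 → Matrix (Fin 15) (Fin 15) S :=
  ![matC s ⊕ᵈ matP s ⊕ᵈ matP s ⊕ᵈ matE ⊕ᵈ matC 1 ⊕ᵈ matJ ⊕ᵈ matE ⊕ᵈ matJ ⊕ᵈ matC 1,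
    matC 1 ⊕ᵈ matK ⊕ᵈ matK ⊕ᵈ matP s ⊕ᵈ matC s ⊕ᵈ matQ s ⊕ᵈ matJ ⊕ᵈ matJ ⊕ᵈ matC 1,
    matC 1 ⊕ᵈ matK ⊕ᵈ matE ⊕ᵈ matK ⊕ᵈ matC 1 ⊕ᵈ matE ⊕ᵈ matQ s ⊕ᵈ matQ s ⊕ᵈ matC s]

/-- The index set `{(i, j) : i < j}`. -/
abbrev PairIdx (n : ℕ) : Type := {p : Fin n × Fin n // p.1 < p.2}

theorem card_pairIdx (n : ℕ) : Fintype.card (PairIdx n) = n.choose 2 := by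
  let e : PairIdx n ≃ (Σ j : Fin n, Fin j) :=
    { toFun := fun p => ⟨p.1.2, ⟨p.1.1, p.2⟩⟩
      invFun := fun q => ⟨(⟨q.2, q.2.2.trans q.1.2⟩, q.1), q.2.2⟩
      left_inv := fun _ => rfl
      right_inv := fun _ => rfl }
  rw [Fintype.card_congr e, Fintype.card_sigma]
  simp only [Fintype.card_fin]
  rw [Fin.sum_univ_eq_sum_range (fun j => j) n, Finset.sum_range_id, Nat.choose_two_right]

/-- The letter map sending `lo ↦ [a]`, `hi ↦ [b]`, every `k` strictly between them to `[ba]`,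
and all other letters to the empty word. -/
def segment {n : ℕ} (lo hi : Fin n) (a b : Fin 3) (k : Fin n) : Baxt 3 :=
  if k = lo then Baxt.mk [a]
  else if k = hi then Baxt.mk [b]
  else if lo < k ∧ k < hi then Baxt.mk [b, a]
  else 1

/-- The map from letters to `Baxt 3 × Baxt 3` attached to a pair `i < j`, where `j♯ = j.rev`
and `i♯ = i.rev`. The letters `1, 2, 3` of `Baxt 3` are `0, 1, 2 : Fin 3`. -/
def pairLetter {n : ℕ} (i j : Fin n) (k : Fin n) : Baxt 3 × Baxt 3 :=
  if i.rev = j then (segment i j 0 2 k, segment i j 0 2 k)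
  else if j < i.rev then (segment i j 0 1 k, segment j.rev i.rev 1 2 k)
  else (segment j.rev i.rev 0 1 k, segment i j 1 2 k)

/-- The involution `(x, y) ↦ (y♯, x♯)` on `Baxt 3 × Baxt 3`. -/
def swapSharp (x : Baxt 3 × Baxt 3) : Baxt 3 × Baxt 3 := (star x.2, star x.1)

/-- Rearrangement of a family of pairs, enumerated by `e`, into the single list: the first
components in order, followed by the second components in reverse order. -/
def unfoldPairs {I X : Type*} {m : ℕ} (e : Fin m ≃ I) (x : I → X × X) : Fin (m + m) → X :=
  Fin.append (fun b => (x (e b)).1) (fun b => (x (e b.rev)).2)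

/-- The block diagonal matrix of size `30 m` with `2 m` consecutive diagonal blocks
of size `15`. -/
def diagBlocks {m : ℕ} (A : Fin (m + m) → Matrix (Fin 15) (Fin 15) S) :
    Matrix (Fin (30 * m)) (Fin (30 * m)) S :=
  let e : Fin 15 × Fin (m + m) ≃ Fin (30 * m) :=
    (Equiv.prodComm _ _).trans (finProdFinEquiv.trans (finCongr (by ring)))
  Matrix.reindex e e (Matrix.blockDiagonal A)

/-- An element all of whose powers are distinct. -/
def HasInfiniteMulOrder (s : S) : Prop := ∀ i j : ℕ, s ^ i = s ^ j ↔ i = j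

end Construction

/-- The tropical semiring: `ℝ ∪ {-∞}` with maximum as addition and `+` as multiplication.
(`Tropical` uses the minimum, hence the order dual; `⊤ : WithTop ℝᵒᵈ` is `-∞`.) -/
abbrev MaxPlus : Type := Tropical (WithTop ℝᵒᵈ)

end Baxter

open Baxter

/-! A Baxter class has a complete set of numerical invariants: the content of the word and, for
every pair `a < c`, the number of `a`s before the first letter in `(a, c]` (`iocRun`) and the number
of `c`s after the last letter in `[a, c)` (`icoRun` of the reversed word). The second family
determines the right strict tree, because the root is the last letter and its two subtrees come from
the subwords of smaller-or-equal and of larger letters; reversing the order gives the first family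
from the left strict tree. This is `baxterTrees_eq_iff`.

A pair `i < j` can then be treated on its own. Replacing `i`, `j` by letters `a < b`, each letter
between them by `ba` and the rest by nothing keeps both runs of the pair: `ba` shows `b` first from
the left and `a` first from the right, so it ends either run. Adjacent pairs also recover the
content, so the substitutions jointly separate classes. Each is paired with its mirror image to make
the map respect the involution.

In rank three each invariant is an exponent of `s`. Scalars count letters. In a product of `P`, `K`,
`E`, the leftmost `K` erases what follows it, so only the `P`s before it count; `Q`, `J`, `E` are
the skew transposes and count from the right. Nine blocks carry the three counts and six runs,
arranged so that skew transposition permutes them as the involution does. -/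

namespace Baxter

/-! ### Counting a letter up to the first stopping letter -/

section Runs

variable {α β : Type*}

/-- The number of occurrences of `x` in the longest prefix of a word that avoids `p`. -/
def runCount [DecidableEq α] (p : α → Bool) (x : α) : List α → ℕ
  | [] => 0
  | k :: w => if p k then 0 else if k = x then runCount p x w + 1 else runCount p x w

/-- A deleted letter is neither a stopping letter nor `x`, so it has no effect on the run. -/
theorem runCount_filter [DecidableEq α] {p q : α → Bool} {x : α} (hp : ∀ k, p k → q k)
    (hx : q x) (w : List α) : runCount p x (w.filter q) = runCount p x w := by
  induction w with
  | nil => rfl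
  | cons k w ih =>
    by_cases hq : q k
    · simp [hq, runCount, ih]
    · have h1 : ¬ p k := fun h => hq (hp k h)
      have h2 : k ≠ x := fun h => hq (h ▸ hx)
      simp [hq, runCount, ih, h1, h2]

theorem runCount_map [DecidableEq α] [DecidableEq β] {f : α → β} (hf : Function.Injective f)
    (p : β → Bool) (x : α) (w : List α) :
    runCount p (f x) (w.map f) = runCount (fun k => p (f k)) x w := by
  induction w with
  | nil => rfl
  | cons k w ih => simp [runCount, ih, hf.eq_iff]

theorem runCount_eq_count [DecidableEq α] {p : α → Bool} {x : α} {w : List α}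
    (h : ∀ k ∈ w, ¬ p k) : runCount p x w = w.count x := by
  induction w with
  | nil => rfl
  | cons k w ih =>
    have h1 := h k (by simp)
    have h2 := ih fun l hl => h l (by simp [hl])
    simp [runCount, h1, h2, List.count_cons]
    split <;> rfl

end Runs

/-! ### Complete invariants of Baxter classes -/

section Invariants

variable {α : Type*} [LinearOrder α]

/-- The number of `c`s before the first letter in `[a, c)`. -/
def icoRun (a c : α) (w : List α) : ℕ := runCount (fun k => decide (a ≤ k ∧ k < c)) c w

/-- The number of `a`s before the first letter in `(a, c]`. -/
def iocRun (a c : α) (w : List α) : ℕ := runCount (fun k => decide (a < k ∧ k ≤ c)) a w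

/-- The interval `[c, c)` is empty, so nothing stops the run. In this way the content becomes a
degenerate case of the runs. -/
theorem icoRun_self (c : α) (w : List α) : icoRun c c w = w.count c :=
  runCount_eq_count fun k _ => by simp

theorem icoRun_cons (a c k : α) (w : List α) : icoRun a c (k :: w) =
    if a ≤ k ∧ k < c then 0 else if k = c then icoRun a c w + 1 else icoRun a c w := by
  simp [icoRun, runCount]

theorem iocRun_cons (a c k : α) (w : List α) : iocRun a c (k :: w) =
    if a < k ∧ k ≤ c then 0 else if k = a then iocRun a c w + 1 else iocRun a c w := by
  simp [iocRun, runCount]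

theorem icoRun_filter_le {a c x : α} (h : c ≤ x) (w : List α) :
    icoRun a c (w.filter (fun k => k ≤ x)) = icoRun a c w :=
  runCount_filter (fun k hk => by simp at hk ⊢; exact hk.2.le.trans h) (by simpa) w

theorem icoRun_filter_lt {a c x : α} (h : x < a) (h' : x < c) (w : List α) :
    icoRun a c (w.filter (fun k => x < k)) = icoRun a c w :=
  runCount_filter (fun k hk => by simp at hk ⊢; exact h.trans_le hk.1) (by simpa) w

/-- The value of `icoRun` read off from a right strict binary search tree. -/
def treeRun (a c : α) : BinaryTree α → ℕ
  | .nil => 0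
  | .node x l r =>
    if a ≤ x ∧ x < c then 0 else if x = c then treeRun a c l + 1
      else if x < c then treeRun a c r else treeRun a c l

theorem rsTree_reverse_cons (x : α) (w : List α) :
    rsTree (x :: w).reverse =
      .node x (rsTree (w.filter (fun k => k ≤ x)).reverse)
        (rsTree (w.filter (fun k => x < k)).reverse) := by
  rw [List.reverse_cons, rsTree, List.foldr_append]
  exact (foldr_rsInsert_node x .nil .nil w.reverse).trans (by simp [rsTree, List.filter_reverse])

/-- Induct on the length by way of the root `x`. If `x` lies in `[a, c)` the run ends at once.
Otherwise `x < c` forces `x < a`, and all letters that matter are sent to the right subtree; `c ≤ x`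
sends them all to the left one. Hence the run depends only on the tree. -/
theorem treeRun_rsTree_reverse (a c : α) (w : List α) :
    treeRun a c (rsTree w.reverse) = icoRun a c w := by
  induction h : w.length using Nat.strong_induction_on generalizing w with
  | _ n ih =>
    cases w with
    | nil => rfl
    | cons x w =>
      subst h
      have hlen (q : α → Bool) : (w.filter q).length < (x :: w).length :=
        Nat.lt_succ_of_le (List.length_filter_le _ _)
      rw [rsTree_reverse_cons, treeRun, icoRun_cons, ih _ (hlen _) _ rfl, ih _ (hlen _) _ rfl]
      by_cases h1 : a ≤ x ∧ x < c
      · simp [h1]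
      · rcases lt_trichotomy x c with h | h | h
        · have hx : x < a := not_le.mp fun h' => h1 ⟨h', h⟩
          simp [h, h.ne, icoRun_filter_lt hx h]
        · simp [h, icoRun_filter_le]
        · simp [h.ne', h.not_gt, icoRun_filter_le h.le]

theorem icoRun_congr {u v : List α} (h : rsTree u.reverse = rsTree v.reverse) (a c : α) :
    icoRun a c u = icoRun a c v := by
  rw [← treeRun_rsTree_reverse, h, treeRun_rsTree_reverse]

theorem perm_of_rsTree_eq {u v : List α} (h : rsTree u = rsTree v) : u.Perm v := by
  rw [← u.reverse_reverse, ← v.reverse_reverse] at h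
  exact List.perm_iff_count.mpr fun c => by simpa [icoRun_self] using icoRun_congr h c c

/-- If the first letters were `x < y`, the run for the pair `(x, y)` would be zero in the word
starting with `x` and positive in the other. So the roots agree, and the hypotheses pass to the two
filtered subwords. -/
theorem rsTree_reverse_eq_of_icoRun {u v : List α} (hp : u.Perm v)
    (h : ∀ a ∈ u, ∀ c ∈ u, a < c → icoRun a c u = icoRun a c v) :
    rsTree u.reverse = rsTree v.reverse := by
  induction hn : u.length using Nat.strong_induction_on generalizing u v with
  | _ n ih =>
    cases u with
    | nil => rw [hp.nil_eq]
    | cons x u =>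
      cases v with
      | nil => simp at hp
      | cons y v =>
        subst hn
        obtain rfl : x = y := by
          rcases lt_trichotomy x y with hxy | hxy | hxy
          · have := h x (by simp) y (hp.mem_iff.mpr (by simp)) hxy
            simp [icoRun_cons, hxy] at this
          · exact hxy
          · have := h y (hp.mem_iff.mpr (by simp)) x (by simp) hxy
            simp [icoRun_cons, hxy] at this
        have hp' := (List.perm_cons x).mp hp
        have hlen (q : α → Bool) : (u.filter q).length < (x :: u).length :=
          Nat.lt_succ_of_le (List.length_filter_le _ _)
        rw [rsTree_reverse_cons, rsTree_reverse_cons,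
          ih _ (hlen _) (hp'.filter (fun k => decide (k ≤ x))) _ rfl,
          ih _ (hlen _) (hp'.filter (fun k => decide (x < k))) _ rfl]
        · intro a ha c hc hac
          simp only [List.mem_filter, decide_eq_true_eq] at ha hc
          have := h a (by simp [ha.1]) c (by simp [hc.1]) hac
          simp only [icoRun_cons, ha.2.not_ge, hc.2.ne] at this
          rw [icoRun_filter_lt ha.2 hc.2, icoRun_filter_lt ha.2 hc.2]
          simpa using this
        · intro a ha c hc hac
          simp only [List.mem_filter, decide_eq_true_eq] at ha hc
          have := h a (by simp [ha.1]) c (by simp [hc.1]) hac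
          simp only [icoRun_cons, hc.2.not_gt, and_false, if_false] at this
          rw [icoRun_filter_le hc.2, icoRun_filter_le hc.2]
          -- If `c = x`, the removed root contributes one to both runs; otherwise it contributes
          -- nothing.
          by_cases hx : x = c <;> simpa [hx] using this

theorem icoRun_map_toDual (a c : α) (w : List α) :
    icoRun (OrderDual.toDual c) (OrderDual.toDual a) (w.map OrderDual.toDual) =
      iocRun a c w := by
  rw [icoRun, runCount_map OrderDual.toDual.injective, iocRun]
  congr 1
  funext k
  simp [and_comm]

theorem lsTree_eq_iff {u v : List α} : lsTree u = lsTree v ↔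
    rsTree (u.map OrderDual.toDual).reverse = rsTree (v.map OrderDual.toDual).reverse := by
  have hf : StrictAnti (OrderDual.toDual : α → αᵒᵈ) := fun _ _ h => h
  rw [← mirror_lsTree _ hf, ← mirror_lsTree _ hf, (mirror_injective _ hf.injective).eq_iff]

/-- Only pairs of letters that occur need testing, which later makes words over a two-letter
subalphabet a matter of a single pair. -/
theorem baxterTrees_eq_iff {u v : List α} : baxterTrees u = baxterTrees v ↔ u.Perm v ∧
    (∀ a ∈ u, ∀ c ∈ u, a < c → icoRun a c u.reverse = icoRun a c v.reverse) ∧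
    ∀ a ∈ u, ∀ c ∈ u, a < c → iocRun a c u = iocRun a c v := by
  simp only [baxterTrees, Prod.mk.injEq, lsTree_eq_iff]
  constructor
  · rintro ⟨hl, hr⟩
    refine ⟨perm_of_rsTree_eq hr, fun a _ c _ _ => ?_, fun a _ c _ _ => ?_⟩
    · exact icoRun_congr (by simpa using hr) a c
    · rw [← icoRun_map_toDual, icoRun_congr hl, icoRun_map_toDual]
  · rintro ⟨hp, hr, hl⟩
    constructor
    · refine rsTree_reverse_eq_of_icoRun (hp.map _) fun a ha c hc hac => ?_
      simp only [List.mem_map] at ha hc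
      obtain ⟨a, ha, rfl⟩ := ha
      obtain ⟨c, hc, rfl⟩ := hc
      rw [icoRun_map_toDual, icoRun_map_toDual, hl c hc a ha hac]
    · have := rsTree_reverse_eq_of_icoRun (u := u.reverse) (v := v.reverse)
        (((List.reverse_perm u).trans hp).trans (List.reverse_perm v).symm) (by simpa using hr)
      simpa using this

theorem icoRun_reverse_congr {u v : List α} (h : baxterTrees u = baxterTrees v) (a c : α) :
    icoRun a c u.reverse = icoRun a c v.reverse := by
  simp only [baxterTrees, Prod.mk.injEq] at h
  exact icoRun_congr (by simpa using h.2) a c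

theorem iocRun_congr {u v : List α} (h : baxterTrees u = baxterTrees v) (a c : α) :
    iocRun a c u = iocRun a c v := by
  simp only [baxterTrees, Prod.mk.injEq, lsTree_eq_iff] at h
  rw [← icoRun_map_toDual, icoRun_congr h.1, icoRun_map_toDual]

end Invariants

/-! ### Reduction to rank three, one pair of letters at a time -/

section Substitution

variable {n m : ℕ}

theorem Baxt.mk_eq_mk {u v : List (Fin n)} :
    Baxt.mk u = Baxt.mk v ↔ baxterTrees u = baxterTrees v :=
  Con.eq _

theorem Baxt.induction {motive : Baxt n → Prop} (x : Baxt n) (one : motive 1)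
    (letter_mul : ∀ k x, motive x → motive (Baxt.mk [k] * x)) : motive x := by
  induction x using Con.induction_on with
  | H w =>
    induction w using FreeMonoid.inductionOn' with
    | one => exact one
    | of_mul k w ih => exact letter_mul k _ ih

theorem Baxt.mk_append (u v : List (Fin n)) : Baxt.mk (u ++ v) = Baxt.mk u * Baxt.mk v := rfl

/-- The monoid homomorphism extending a letter map that respects the Baxter congruence. -/
def Baxt.lift {M : Type*} [Monoid M] (f : Fin n → M)
    (h : ∀ u v : List (Fin n), baxterTrees u = baxterTrees v →
      (u.map f).prod = (v.map f).prod) : Baxt n →* M :=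
  (baxtCon n).lift (FreeMonoid.lift f) fun u v huv => by
    simpa [FreeMonoid.lift_apply] using h u.toList v.toList huv

theorem Baxt.lift_mk {M : Type*} [Monoid M] (f : Fin n → M) (h) (w : List (Fin n)) :
    Baxt.lift f h (Baxt.mk w) = (w.map f).prod :=
  FreeMonoid.lift_apply f _

/-- A word representing `segment lo hi a b k`. -/
def segmentWord (lo hi : Fin n) (a b : Fin 3) (k : Fin n) : List (Fin 3) :=
  if k = lo then [a] else if k = hi then [b] else if lo < k ∧ k < hi then [b, a] else []

theorem mk_segmentWord (lo hi : Fin n) (a b : Fin 3) (k : Fin n) :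
    Baxt.mk (segmentWord lo hi a b k) = segment lo hi a b k := by
  unfold segmentWord segment
  split_ifs <;> rfl

theorem prod_segment (lo hi : Fin n) (a b : Fin 3) (w : List (Fin n)) :
    (w.map (segment lo hi a b)).prod = Baxt.mk (w.flatMap (segmentWord lo hi a b)) := by
  induction w with
  | nil => rfl
  | cons k w ih =>
    rw [List.map_cons, List.prod_cons, ih, ← mk_segmentWord, List.flatMap_cons, Baxt.mk_append]

theorem mem_segmentWord {lo hi : Fin n} {a b c : Fin 3} {k : Fin n}
    (h : c ∈ segmentWord lo hi a b k) : c = a ∨ c = b := by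
  unfold segmentWord at h
  split_ifs at h <;> simp at h <;> tauto

theorem mem_flatMap_segmentWord {lo hi : Fin n} {a b c : Fin 3} {w : List (Fin n)}
    (h : c ∈ w.flatMap (segmentWord lo hi a b)) : c = a ∨ c = b := by
  obtain ⟨k, -, hk⟩ := List.mem_flatMap.mp h
  exact mem_segmentWord hk

/-- Read from the left, the images of `hi` and of every interior letter start with `b` and end the
run; `lo` adds one to it, and the remaining letters vanish. -/
theorem iocRun_flatMap_segmentWord {lo hi : Fin n} {a b : Fin 3} (hab : a < b) (h : lo < hi)
    (w : List (Fin n)) :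
    iocRun a b (w.flatMap (segmentWord lo hi a b)) = iocRun lo hi w := by
  induction w with
  | nil => rfl
  | cons k w ih =>
    rw [List.flatMap_cons, segmentWord, iocRun_cons]
    split_ifs with h1 h2 h3 h4 h5 h6 h7 <;>
      simp [iocRun_cons, ih, hab] <;> grind

/-- Read from the right, `ba` shows `a` first, so interior letters end this run too. This is why
their image is `ba` and not `ab`. -/
theorem icoRun_reverse_flatMap_segmentWord {lo hi : Fin n} {a b : Fin 3} (hab : a < b)
    (h : lo < hi) (w : List (Fin n)) :
    icoRun a b (w.flatMap (segmentWord lo hi a b)).reverse = icoRun lo hi w.reverse := by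
  rw [List.reverse_flatMap]
  induction w.reverse with
  | nil => rfl
  | cons k w ih =>
    rw [List.flatMap_cons, icoRun_cons, Function.comp_apply, segmentWord]
    split_ifs with h1 h2 h3 h4 h5 h6 h7 <;>
      simp [icoRun_cons, ih, hab] <;> grind

/-- Between adjacent letters there is no interior letter to contribute spurious occurrences. -/
theorem count_low_flatMap_segmentWord {lo hi : Fin n} {a b : Fin 3} (hab : a < b)
    (h : lo ⋖ hi) (w : List (Fin n)) :
    (w.flatMap (segmentWord lo hi a b)).count a = w.count lo := by
  induction w with
  | nil => rfl
  | cons k w ih =>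
    have h' : ¬ (lo < k ∧ k < hi) := fun hk => h.2 hk.1 hk.2
    rw [List.flatMap_cons, List.count_append, ih, List.count_cons, segmentWord, if_neg h']
    split_ifs <;> simp_all [hab.ne', add_comm]

theorem count_high_flatMap_segmentWord {lo hi : Fin n} {a b : Fin 3} (hab : a < b)
    (h : lo ⋖ hi) (w : List (Fin n)) :
    (w.flatMap (segmentWord lo hi a b)).count b = w.count hi := by
  induction w with
  | nil => rfl
  | cons k w ih =>
    have h' : ¬ (lo < k ∧ k < hi) := fun hk => h.2 hk.1 hk.2
    have := h.lt.ne
    rw [List.flatMap_cons, List.count_append, ih, List.count_cons, segmentWord, if_neg h']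
    split_ifs <;> simp_all [hab.ne, add_comm]

theorem baxterTrees_flatMap_segmentWord {lo hi : Fin n} {a b : Fin 3} (hab : a < b)
    (h : lo < hi) {u v : List (Fin n)} (huv : baxterTrees u = baxterTrees v) :
    baxterTrees (u.flatMap (segmentWord lo hi a b)) =
      baxterTrees (v.flatMap (segmentWord lo hi a b)) := by
  have key {x y : Fin 3} (hx : x ∈ u.flatMap (segmentWord lo hi a b))
      (hy : y ∈ u.flatMap (segmentWord lo hi a b)) (hxy : x < y) : x = a ∧ y = b := by
    have := mem_flatMap_segmentWord hx
    have := mem_flatMap_segmentWord hy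
    grind
  refine baxterTrees_eq_iff.mpr ⟨(baxterTrees_eq_iff.mp huv).1.flatMap_right _,
    fun x hx y hy hxy => ?_, fun x hx y hy hxy => ?_⟩
  · obtain ⟨rfl, rfl⟩ := key hx hy hxy
    rw [icoRun_reverse_flatMap_segmentWord hab h, icoRun_reverse_flatMap_segmentWord hab h,
      icoRun_reverse_congr huv]
  · obtain ⟨rfl, rfl⟩ := key hx hy hxy
    rw [iocRun_flatMap_segmentWord hab h, iocRun_flatMap_segmentWord hab h, iocRun_congr huv]

/-- The homomorphism extending `segment lo hi a b`. -/
def segmentHom {lo hi : Fin n} {a b : Fin 3} (hab : a < b) (h : lo < hi) : Baxt n →* Baxt 3 :=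
  Baxt.lift (segment lo hi a b) fun u v huv => by
    rw [prod_segment, prod_segment, Baxt.mk_eq_mk]
    exact baxterTrees_flatMap_segmentWord hab h huv

theorem segmentHom_mk {lo hi : Fin n} {a b : Fin 3} (hab : a < b) (h : lo < hi)
    (w : List (Fin n)) :
    segmentHom hab h (Baxt.mk w) = Baxt.mk (w.flatMap (segmentWord lo hi a b)) := by
  rw [segmentHom, Baxt.lift_mk, prod_segment]

theorem segmentHom_letter {lo hi : Fin n} {a b : Fin 3} (hab : a < b) (h : lo < hi)
    (k : Fin n) : segmentHom hab h (Baxt.mk [k]) = segment lo hi a b k := by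
  simp [segmentHom, Baxt.lift_mk]

/-- The involution exchanges the roles of the low and high letters and also reverses words, so the
pattern "high then low" of interior letters is preserved. -/
theorem star_segment {lo hi : Fin n} (h : lo < hi) (a b : Fin 3) (k : Fin n) :
    star (segment lo hi a b k) = segment hi.rev lo.rev b.rev a.rev k.rev := by
  have h' := h.ne
  have e : (hi.rev < k.rev ∧ k.rev < lo.rev) ↔ (lo < k ∧ k < hi) := by
    rw [Fin.rev_lt_rev, Fin.rev_lt_rev, and_comm]
  unfold segment
  simp only [Fin.rev_inj, e]
  split_ifs <;> first | rfl | simp_all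

theorem star_segmentHom {lo hi : Fin n} {a b : Fin 3} (hab : a < b) (h : lo < hi)
    (x : Baxt n) : star (segmentHom hab h x) =
      segmentHom (Fin.rev_lt_rev.mpr hab) (Fin.rev_lt_rev.mpr h) (star x) := by
  induction x using Baxt.induction with
  | one => simp
  | letter_mul k x ih =>
    rw [map_mul, star_mul, star_mul, map_mul, ih, segmentHom_letter, star_segment h]
    congr 1

/-- The homomorphism extending `pairLetter i j`. -/
def pairHom (i j : Fin n) (h : i < j) : Baxt n →* Baxt 3 × Baxt 3 :=
  have h' : j.rev < i.rev := Fin.rev_lt_rev.mpr h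
  if i.rev = j then
    (segmentHom (a := 0) (b := 2) (by decide) h).prod (segmentHom (a := 0) (b := 2) (by decide) h)
  else if j < i.rev then
    (segmentHom (a := 0) (b := 1) (by decide) h).prod (segmentHom (a := 1) (b := 2) (by decide) h')
  else
    (segmentHom (a := 0) (b := 1) (by decide) h').prod (segmentHom (a := 1) (b := 2) (by decide) h)

theorem pairHom_letter (i j : Fin n) (h : i < j) (k : Fin n) :
    pairHom i j h (Baxt.mk [k]) = pairLetter i j k := by
  unfold pairHom pairLetter
  split_ifs <;> simp [segmentHom_letter]

theorem segmentHom_congr {lo hi lo' hi' : Fin n} {a b a' b' : Fin 3} (hab : a < b) (h : lo < hi)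
    (hab' : a' < b') (h' : lo' < hi') (x : Baxt n) (h1 : lo = lo') (h2 : hi = hi') (h3 : a = a')
    (h4 : b = b') : segmentHom hab h x = segmentHom hab' h' x := by
  subst h1 h2 h3 h4
  rfl

/-- In each case the two components are mirror images of each other; when `i.rev = j`, the pair and
the letters `0, 2` are their own mirror images. -/
theorem pairHom_star (i j : Fin n) (h : i < j) (x : Baxt n) :
    pairHom i j h (star x) = swapSharp (pairHom i j h x) := by
  unfold pairHom swapSharp
  dsimp only
  split_ifs with h1
  · subst h1
    ext
    all_goals
      simp only [MonoidHom.prod_apply, star_segmentHom]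
      exact segmentHom_congr _ _ _ _ _ (by simp) (by simp) rfl rfl
  all_goals
    ext <;> simp only [MonoidHom.prod_apply, star_segmentHom]
    exact segmentHom_congr _ _ _ _ _ (by simp) (by simp) rfl rfl

/-- Separating classes uses only the component built on `(i, j)` itself; which letters of rank three
it uses is immaterial. -/
theorem exists_segmentHom_eq_of_pairHom_eq {i j : Fin n} (h : i < j) {x y : Baxt n}
    (hxy : pairHom i j h x = pairHom i j h y) :
    ∃ (a b : Fin 3) (hab : a < b), segmentHom hab h x = segmentHom hab h y := by
  unfold pairHom at hxy
  dsimp only at hxy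
  split_ifs at hxy <;> simp only [MonoidHom.prod_apply, Prod.mk.injEq] at hxy
  exacts [⟨_, _, _, hxy.1⟩, ⟨_, _, _, hxy.1⟩, ⟨_, _, _, hxy.2⟩]

/-- The homomorphism with components `pairHom`. -/
def pairsHom (n : ℕ) : Baxt n →* (PairIdx n → Baxt 3 × Baxt 3) :=
  MonoidHom.pi fun p => pairHom p.1.1 p.1.2 p.2

theorem pairsHom_injective (hn : 2 ≤ n) : Function.Injective (pairsHom n) := by
  intro x y hxy
  induction x using Con.induction_on with
  | H u =>
  induction y using Con.induction_on with
  | H v =>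
  change List (Fin n) at u v
  have key (i j : Fin n) (h : i < j) : ∃ (a b : Fin 3) (_ : a < b),
      baxterTrees (u.flatMap (segmentWord i j a b)) =
        baxterTrees (v.flatMap (segmentWord i j a b)) := by
    obtain ⟨a, b, hab, e⟩ := exists_segmentHom_eq_of_pairHom_eq h (congrFun hxy ⟨(i, j), h⟩)
    exact ⟨a, b, hab, Baxt.mk_eq_mk.mp
      ((segmentHom_mk hab h u).symm.trans (e.trans (segmentHom_mk hab h v)))⟩
  have covBy (i j : Fin n) (h : i.val + 1 = j.val) : i ⋖ j :=
    ⟨by rw [Fin.lt_def]; lia, fun k hk hk' => by rw [Fin.lt_def] at hk hk'; lia⟩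
  refine Baxt.mk_eq_mk.mpr (baxterTrees_eq_iff.mpr
    ⟨List.perm_iff_count.mpr fun k => ?_, fun i _ j _ h => ?_, fun i _ j _ h => ?_⟩)
  -- Each letter is counted through an adjacent pair: with its successor, or with its predecessor if
  -- it is the last letter. The predecessor exists because `2 ≤ n`.
  · by_cases hk : k.val + 1 < n
    · have hc := covBy k ⟨k.val + 1, hk⟩ rfl
      obtain ⟨a, b, hab, e⟩ := key _ _ hc.lt
      have := (baxterTrees_eq_iff.mp e).1.count_eq a
      rwa [count_low_flatMap_segmentWord hab hc, count_low_flatMap_segmentWord hab hc] at this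
    · have hc := covBy ⟨k.val - 1, by lia⟩ k (by dsimp only; lia)
      obtain ⟨a, b, hab, e⟩ := key _ _ hc.lt
      have := (baxterTrees_eq_iff.mp e).1.count_eq b
      rwa [count_high_flatMap_segmentWord hab hc, count_high_flatMap_segmentWord hab hc] at this
  · obtain ⟨a, b, hab, e⟩ := key i j h
    have := icoRun_reverse_congr e a b
    rwa [icoRun_reverse_flatMap_segmentWord hab h,
      icoRun_reverse_flatMap_segmentWord hab h] at this
  · obtain ⟨a, b, hab, e⟩ := key i j h
    have := iocRun_congr e a b
    rwa [iocRun_flatMap_segmentWord hab h, iocRun_flatMap_segmentWord hab h] at this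

end Substitution

/-! ### Skew transposes, block sums and the 2 × 2 blocks -/

section BlockMatrices

theorem skewTranspose_injective {S : Type*} {N : ℕ} :
    Function.Injective (skewTranspose : Matrix (Fin N) (Fin N) S → _) := by
  intro A B h
  ext i j
  simpa [skewTranspose] using congrFun₂ h j.rev i.rev

variable {S : Type*} [CommSemiring S]

theorem skewTranspose_one {N : ℕ} : skewTranspose (1 : Matrix (Fin N) (Fin N) S) = 1 := by
  ext i j
  simp [skewTranspose, Matrix.one_apply, eq_comm]

theorem skewTranspose_mul {N : ℕ} (A B : Matrix (Fin N) (Fin N) S) :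
    skewTranspose (A * B) = skewTranspose B * skewTranspose A := by
  ext i j
  simp only [skewTranspose, Matrix.of_apply, Matrix.mul_apply]
  rw [← Equiv.sum_comp Fin.revPerm]
  exact Finset.sum_congr rfl fun k _ => by simp [mul_comm]

theorem dsum_one {k l : ℕ} : dsum (1 : Matrix (Fin k) (Fin k) S) (1 : Matrix (Fin l) (Fin l) S) =
    1 := by
  simp [dsum]

theorem dsum_mul {k l : ℕ} (A A' : Matrix (Fin k) (Fin k) S) (B B' : Matrix (Fin l) (Fin l) S) :
    dsum A B * dsum A' B' = dsum (A * A') (B * B') := by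
  simp [dsum, Matrix.submatrix_mul_equiv, Matrix.fromBlocks_multiply]

theorem dsum_inj {k l : ℕ} {A A' : Matrix (Fin k) (Fin k) S} {B B' : Matrix (Fin l) (Fin l) S} :
    dsum A B = dsum A' B' ↔ A = A' ∧ B = B' := by
  simp only [dsum, (Matrix.reindex _ _).injective.eq_iff, Matrix.fromBlocks_inj, true_and]

theorem dsum_isUpperTriangular {k l : ℕ} {A : Matrix (Fin k) (Fin k) S}
    {B : Matrix (Fin l) (Fin l) S} (hA : A.IsUpperTriangular) (hB : B.IsUpperTriangular) :
    (dsum A B).IsUpperTriangular := by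
  intro i j hij
  induction i using Fin.addCases with
  | left i =>
    induction j using Fin.addCases with
    | left j => simpa [dsum] using hA (show j < i from hij)
    | right j => simp [dsum]
  | right i =>
    induction j using Fin.addCases with
    | left j => simp [dsum]
    | right j => simpa [dsum] using hB (show j < i by simpa using hij)

theorem prod_map_dsum {α : Type*} {k l : ℕ} (f : α → Matrix (Fin k) (Fin k) S)
    (g : α → Matrix (Fin l) (Fin l) S) (w : List α) :
    (w.map fun a => dsum (f a) (g a)).prod = dsum (w.map f).prod (w.map g).prod := by
  induction w with
  | nil => exact dsum_one.symm
  | cons a w ih => simp only [List.map_cons, List.prod_cons, ih, dsum_mul]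

/-- The letter map `x ↦ P`, `k ↦ K` for the letters `k` satisfying `p`, and `k ↦ E` otherwise. -/
def prefixBlock {α : Type*} [DecidableEq α] (s : S) (p : α → Bool) (x k : α) :
    Matrix (Fin 2) (Fin 2) S :=
  if p k then matK else if k = x then matP s else matE

/-- The letter map `x ↦ Q`, `k ↦ J` for the letters `k` satisfying `p`, and `k ↦ E` otherwise. -/
def suffixBlock {α : Type*} [DecidableEq α] (s : S) (p : α → Bool) (x k : α) :
    Matrix (Fin 2) (Fin 2) S :=
  if p k then matJ else if k = x then matQ s else matE

/-- The letter map `x ↦ s` and `k ↦ 1` for `k ≠ x`. -/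
def countBlock {α : Type*} [DecidableEq α] (s : S) (x k : α) : Matrix (Fin 1) (Fin 1) S :=
  matC (if k = x then s else 1)

theorem skewTranspose_prefixBlock {α : Type*} [DecidableEq α] (s : S) (p : α → Bool) (x k : α) :
    skewTranspose (prefixBlock s p x k) = suffixBlock s p x k := by
  unfold prefixBlock suffixBlock
  split_ifs
  · ext i j; fin_cases i <;> fin_cases j <;> rfl
  · ext i j; fin_cases i <;> fin_cases j <;> rfl
  · exact skewTranspose_one

/-- On matrices with bottom row `(0, 1)`, left multiplication by `K` gives `K` whatever the first
row was, while `P` scales the first row by `s`. -/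
theorem prod_prefixBlock {α : Type*} [DecidableEq α] (s : S) (p : α → Bool) (x : α)
    (w : List α) : (w.map (prefixBlock s p x)).prod =
      if w.any p then !![0, s ^ runCount p x w; 0, 1] else !![s ^ runCount p x w, 0; 0, 1] := by
  induction w with
  | nil => simp [runCount, Matrix.one_fin_two]
  | cons k w ih =>
    rw [List.map_cons, List.prod_cons, ih, prefixBlock, runCount]
    by_cases h2 : k = x
    · subst h2
      by_cases h1 : p k <;> by_cases h3 : w.any p <;>
        simp [h1, h3, -List.any_eq_true, matK, matP, pow_succ']
    · by_cases h1 : p k <;> by_cases h3 : w.any p <;>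
        simp [h1, h2, h3, -List.any_eq_true, matK, matE]

theorem prod_suffixBlock {α : Type*} [DecidableEq α] (s : S) (p : α → Bool) (x : α)
    (w : List α) : (w.map (suffixBlock s p x)).prod =
      skewTranspose (w.reverse.map (prefixBlock s p x)).prod := by
  induction w with
  | nil => simp [skewTranspose_one]
  | cons k w ih => simp [ih, skewTranspose_mul, skewTranspose_prefixBlock]

theorem prod_countBlock {α : Type*} [DecidableEq α] (s : S) (x : α) (w : List α) :
    (w.map (countBlock s x)).prod = matC (s ^ w.count x) := by
  induction w with
  | nil => ext i j; fin_cases i; fin_cases j; simp [matC]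
  | cons k w ih =>
    rw [List.map_cons, List.prod_cons, ih, countBlock, List.count_cons]
    ext i j
    fin_cases i; fin_cases j
    by_cases h : k = x <;> simp [matC, h, Matrix.mul_apply, pow_succ']

theorem prod_prefixBlock_congr {α : Type*} [DecidableEq α] (s : S) {p : α → Bool} {x : α}
    {u v : List α} (hp : u.Perm v) (h : runCount p x u = runCount p x v) :
    (u.map (prefixBlock s p x)).prod = (v.map (prefixBlock s p x)).prod := by
  rw [prod_prefixBlock, prod_prefixBlock, h, hp.any_eq]

theorem runCount_eq_of_prod_prefixBlock_eq {α : Type*} [DecidableEq α] {s : S}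
    (hs : HasInfiniteMulOrder s) {p : α → Bool} {x : α} {u v : List α}
    (h : (u.map (prefixBlock s p x)).prod = (v.map (prefixBlock s p x)).prod) :
    runCount p x u = runCount p x v := by
  -- The power of `s` is in the first or second column according to whether a stopping letter
  -- occurs, the other entry being zero; the row sum avoids the distinction.
  have key (w : List α) : (w.map (prefixBlock s p x)).prod 0 0 +
      (w.map (prefixBlock s p x)).prod 0 1 = s ^ runCount p x w := by
    rw [prod_prefixBlock]
    split_ifs <;> simp
  exact (hs _ _).mp (by rw [← key, h, key])

theorem count_eq_of_prod_countBlock_eq {α : Type*} [DecidableEq α] {s : S}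
    (hs : HasInfiniteMulOrder s) {x : α} {u v : List α}
    (h : (u.map (countBlock s x)).prod = (v.map (countBlock s x)).prod) :
    u.count x = v.count x := by
  rw [prod_countBlock, prod_countBlock] at h
  exact (hs _ _).mp (by simpa [matC] using congrFun₂ h 0 0)

end BlockMatrices

/-! ### The faithful representation in rank three -/

section RankThree

variable {S : Type*} [CommSemiring S]

/-- The predicate selecting the letters in `(a, c]`. -/
abbrev inIoc (a c k : Fin 3) : Bool := decide (a < k ∧ k ≤ c)

/-- The predicate selecting the letters in `[a, c)`. -/
abbrev inIco (a c k : Fin 3) : Bool := decide (a ≤ k ∧ k < c)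

/-- The letter map `baxt3Matrix s`, written blockwise. -/
def baxt3Blocks (s : S) (k : Fin 3) :
    Matrix (Fin (1 + 2 + 2 + 2 + 1 + 2 + 2 + 2 + 1)) (Fin (1 + 2 + 2 + 2 + 1 + 2 + 2 + 2 + 1)) S :=
  countBlock s 0 k ⊕ᵈ prefixBlock s (inIoc 0 2) 0 k ⊕ᵈ prefixBlock s (inIoc 0 1) 0 k ⊕ᵈ
    prefixBlock s (inIoc 1 2) 1 k ⊕ᵈ countBlock s 1 k ⊕ᵈ suffixBlock s (inIco 0 1) 1 k ⊕ᵈ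
    suffixBlock s (inIco 1 2) 2 k ⊕ᵈ suffixBlock s (inIco 0 2) 2 k ⊕ᵈ countBlock s 2 k

theorem baxt3Matrix_eq (s : S) : baxt3Matrix s = baxt3Blocks s := by
  funext k
  fin_cases k <;> rfl

theorem prod_baxt3Blocks (s : S) (w : List (Fin 3)) : (w.map (baxt3Blocks s)).prod =
    (w.map (countBlock s 0)).prod ⊕ᵈ (w.map (prefixBlock s (inIoc 0 2) 0)).prod ⊕ᵈ
      (w.map (prefixBlock s (inIoc 0 1) 0)).prod ⊕ᵈ (w.map (prefixBlock s (inIoc 1 2) 1)).prod ⊕ᵈ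
      (w.map (countBlock s 1)).prod ⊕ᵈ (w.map (suffixBlock s (inIco 0 1) 1)).prod ⊕ᵈ
      (w.map (suffixBlock s (inIco 1 2) 2)).prod ⊕ᵈ (w.map (suffixBlock s (inIco 0 2) 2)).prod ⊕ᵈ
      (w.map (countBlock s 2)).prod := by
  unfold baxt3Blocks
  simp only [prod_map_dsum]

/-- The blocks form a palindrome: the `t`-th from the end is the skew transpose of the `t`-th with
letters reversed, as for the pairs `(0, 1)` and `(1, 2)`. -/
theorem skewTranspose_baxt3Matrix (s : S) (k : Fin 3) :
    skewTranspose (baxt3Matrix s k) = baxt3Matrix s k.rev := by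
  ext i j
  fin_cases k <;> fin_cases i <;> fin_cases j <;> rfl

theorem matC_isUpperTriangular (a : S) : (matC a).IsUpperTriangular := by
  intro i j hij
  exact absurd hij (by simp [Subsingleton.elim i j])

theorem isUpperTriangular_fin_two {A : Matrix (Fin 2) (Fin 2) S} (h : A 1 0 = 0) :
    A.IsUpperTriangular := by
  intro i j hij
  fin_cases i <;> fin_cases j <;> simp_all

theorem countBlock_isUpperTriangular (s : S) (x k : Fin 3) :
    (countBlock s x k).IsUpperTriangular :=
  matC_isUpperTriangular _

theorem prefixBlock_isUpperTriangular (s : S) (p : Fin 3 → Bool) (x k : Fin 3) :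
    (prefixBlock s p x k).IsUpperTriangular := by
  unfold prefixBlock
  split_ifs <;> exact isUpperTriangular_fin_two rfl

theorem suffixBlock_isUpperTriangular (s : S) (p : Fin 3 → Bool) (x k : Fin 3) :
    (suffixBlock s p x k).IsUpperTriangular := by
  unfold suffixBlock
  split_ifs <;> exact isUpperTriangular_fin_two rfl

theorem baxt3Matrix_isUpperTriangular (s : S) (k : Fin 3) :
    (baxt3Matrix s k).IsUpperTriangular := by
  rw [baxt3Matrix_eq]
  -- The size `15` is replaced by the definitionally equal sum of block sizes, so that the lemmas on
  -- `dsum` apply.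
  change (baxt3Blocks s k).IsUpperTriangular
  unfold baxt3Blocks
  repeat' apply dsum_isUpperTriangular
  all_goals first
    | apply countBlock_isUpperTriangular
    | apply prefixBlock_isUpperTriangular
    | apply suffixBlock_isUpperTriangular

theorem prod_baxt3Matrix_congr (s : S) {u v : List (Fin 3)} (h : baxterTrees u = baxterTrees v) :
    (u.map (baxt3Matrix s)).prod = (v.map (baxt3Matrix s)).prod := by
  have hp := (baxterTrees_eq_iff.mp h).1
  have hr := ((List.reverse_perm u).trans hp).trans (List.reverse_perm v).symm
  have h1 (a c : Fin 3) := prod_prefixBlock_congr s hp (iocRun_congr h a c)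
  have h2 (a c : Fin 3) := prod_prefixBlock_congr s hr (icoRun_reverse_congr h a c)
  rw [baxt3Matrix_eq]
  change (u.map (baxt3Blocks s)).prod = (v.map (baxt3Blocks s)).prod
  simp only [prod_baxt3Blocks, prod_suffixBlock, prod_countBlock, hp.count_eq, h1, h2]

/-- The representation of `Baxt 3` by upper triangular matrices. -/
def baxt3Hom (s : S) : Baxt 3 →* Matrix (Fin 15) (Fin 15) S :=
  Baxt.lift (baxt3Matrix s) fun _ _ h => prod_baxt3Matrix_congr s h

theorem baxt3Hom_letter (s : S) (k : Fin 3) : baxt3Hom s (Baxt.mk [k]) = baxt3Matrix s k := by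
  rw [baxt3Hom, Baxt.lift_mk, List.map_singleton, List.prod_singleton]

theorem baxt3Hom_isUpperTriangular (s : S) (x : Baxt 3) :
    (baxt3Hom s x).IsUpperTriangular := by
  induction x using Baxt.induction with
  | one => rw [map_one]; exact Matrix.blockTriangular_one
  | letter_mul k x ih =>
    rw [map_mul, baxt3Hom_letter]
    exact (baxt3Matrix_isUpperTriangular s k).mul ih

theorem baxt3Hom_star (s : S) (x : Baxt 3) :
    baxt3Hom s (star x) = skewTranspose (baxt3Hom s x) := by
  induction x using Baxt.induction with
  | one => rw [star_one, map_one, skewTranspose_one]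
  | letter_mul k x ih =>
    rw [star_mul, map_mul, map_mul, ih, skewTranspose_mul, baxt3Hom_letter,
      skewTranspose_baxt3Matrix, ← baxt3Hom_letter]
    rfl

theorem baxt3Hom_injective {s : S} (hs : HasInfiniteMulOrder s) :
    Function.Injective (baxt3Hom s) := by
  intro x y hxy
  induction x using Con.induction_on with
  | H u =>
  induction y using Con.induction_on with
  | H v =>
  change List (Fin 3) at u v
  replace hxy : (u.map (baxt3Matrix s)).prod = (v.map (baxt3Matrix s)).prod := by
    rw [← Baxt.lift_mk _ fun _ _ h => prod_baxt3Matrix_congr s h,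
      ← Baxt.lift_mk _ fun _ _ h => prod_baxt3Matrix_congr s h]
    exact hxy
  rw [baxt3Matrix_eq] at hxy
  change (u.map (baxt3Blocks s)).prod = (v.map (baxt3Blocks s)).prod at hxy
  simp only [prod_baxt3Blocks, prod_suffixBlock, dsum_inj, skewTranspose_injective.eq_iff] at hxy
  obtain ⟨⟨⟨⟨⟨⟨⟨⟨c0, l02⟩, l01⟩, l12⟩, c1⟩, r01⟩, r12⟩, r02⟩, c2⟩ := hxy
  refine Baxt.mk_eq_mk.mpr (baxterTrees_eq_iff.mpr
    ⟨List.perm_iff_count.mpr fun k => ?_, fun a _ c _ h => ?_, fun a _ c _ h => ?_⟩)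
  · fin_cases k
    exacts [count_eq_of_prod_countBlock_eq hs c0, count_eq_of_prod_countBlock_eq hs c1,
      count_eq_of_prod_countBlock_eq hs c2]
  · fin_cases a <;> fin_cases c <;> first
      | exact absurd h (by decide)
      | exact runCount_eq_of_prod_prefixBlock_eq hs r01
      | exact runCount_eq_of_prod_prefixBlock_eq hs r02
      | exact runCount_eq_of_prod_prefixBlock_eq hs r12
  · fin_cases a <;> fin_cases c <;> first
      | exact absurd h (by decide)
      | exact runCount_eq_of_prod_prefixBlock_eq hs l01
      | exact runCount_eq_of_prod_prefixBlock_eq hs l02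
      | exact runCount_eq_of_prod_prefixBlock_eq hs l12

end RankThree

/-! ### Assembling the representation of rank n -/

section Unfolding

variable {S : Type*} [CommSemiring S] {m : ℕ}

theorem unfoldPairs_castAdd {I X : Type*} (e : Fin m ≃ I) (x : I → X × X) (b : Fin m) :
    unfoldPairs e x (Fin.castAdd m b) = (x (e b)).1 :=
  Fin.append_left _ _ b

theorem unfoldPairs_natAdd {I X : Type*} (e : Fin m ≃ I) (x : I → X × X) (b : Fin m) :
    unfoldPairs e x (Fin.natAdd m b) = (x (e b.rev)).2 :=
  Fin.append_right _ _ b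

theorem unfoldPairs_one {I X : Type*} [One X] (e : Fin m ≃ I) :
    unfoldPairs e (1 : I → X × X) = 1 := by
  ext b
  induction b using Fin.addCases with
  | left b => rw [unfoldPairs_castAdd]; rfl
  | right b => rw [unfoldPairs_natAdd]; rfl

theorem unfoldPairs_mul {I X : Type*} [Mul X] (e : Fin m ≃ I) (x y : I → X × X) :
    unfoldPairs e (x * y) = unfoldPairs e x * unfoldPairs e y := by
  ext b
  rw [Pi.mul_apply]
  induction b using Fin.addCases with
  | left b => simp only [unfoldPairs_castAdd, Pi.mul_apply, Prod.fst_mul]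
  | right b => simp only [unfoldPairs_natAdd, Pi.mul_apply, Prod.snd_mul]

theorem unfoldPairs_injective {I X : Type*} (e : Fin m ≃ I) :
    Function.Injective (unfoldPairs e : (I → X × X) → _) := by
  intro x y h
  funext i
  obtain ⟨b, rfl⟩ := e.surjective i
  ext
  · simpa only [unfoldPairs_castAdd] using congrFun h (Fin.castAdd m b)
  · simpa only [unfoldPairs_natAdd, Fin.rev_rev] using congrFun h (Fin.natAdd m b.rev)

/-- Positions `b` and `b.rev` hold the two components of the same pair, so swapping components is
reversal of the list. -/
theorem unfoldPairs_swapSharp {I : Type*} (e : Fin m ≃ I) (x : I → Baxt 3 × Baxt 3)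
    (b : Fin (m + m)) :
    unfoldPairs e (fun i => swapSharp (x i)) b = star (unfoldPairs e x b.rev) := by
  induction b using Fin.addCases with
  | left b =>
    rw [show (Fin.castAdd m b).rev = Fin.natAdd m b.rev by ext; simp; lia, unfoldPairs_natAdd,
      unfoldPairs_castAdd, Fin.rev_rev]
    rfl
  | right b =>
    rw [show (Fin.natAdd m b).rev = Fin.castAdd m b.rev by ext; simp; lia, unfoldPairs_natAdd,
      unfoldPairs_castAdd]
    rfl

/-- The position of the entry with index `p.1` of the block with index `p.2`. -/
def blockIndex (m : ℕ) : Fin 15 × Fin (m + m) ≃ Fin (30 * m) :=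
  (Equiv.prodComm _ _).trans (finProdFinEquiv.trans (finCongr (by ring)))

theorem blockIndex_val (p : Fin 15 × Fin (m + m)) :
    (blockIndex m p).val = p.1.val + 15 * p.2.val := rfl

/-- `30m - 1 - (i + 15b) = (14 - i) + 15(2m - 1 - b)`. -/
theorem blockIndex_rev (p : Fin 15 × Fin (m + m)) :
    (blockIndex m p).rev = blockIndex m (p.1.rev, p.2.rev) := by
  ext
  simp only [Fin.val_rev, blockIndex_val]
  lia

theorem diagBlocks_apply (A : Fin (m + m) → Matrix (Fin 15) (Fin 15) S)
    (p q : Fin 15 × Fin (m + m)) : diagBlocks A (blockIndex m p) (blockIndex m q) =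
      if p.2 = q.2 then A p.2 p.1 q.1 else 0 := by
  change Matrix.reindex (blockIndex m) (blockIndex m) (Matrix.blockDiagonal A) _ _ = _
  simp [Matrix.blockDiagonal_apply]

theorem diagBlocks_one : diagBlocks (1 : Fin (m + m) → Matrix (Fin 15) (Fin 15) S) = 1 := by
  change (Matrix.blockDiagonal 1).submatrix (blockIndex m).symm (blockIndex m).symm = 1
  rw [Matrix.blockDiagonal_one, Matrix.submatrix_one_equiv]

theorem diagBlocks_mul (A B : Fin (m + m) → Matrix (Fin 15) (Fin 15) S) :
    diagBlocks (A * B) = diagBlocks A * diagBlocks B := by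
  simp only [diagBlocks, Matrix.reindex_apply, Matrix.submatrix_mul_equiv,
    ← Matrix.blockDiagonal_mul]
  rfl

theorem diagBlocks_injective :
    Function.Injective (diagBlocks : (Fin (m + m) → Matrix (Fin 15) (Fin 15) S) → _) :=
  fun _ _ h => Matrix.blockDiagonal_injective ((Matrix.reindex _ _).injective h)

theorem diagBlocks_isUpperTriangular {A : Fin (m + m) → Matrix (Fin 15) (Fin 15) S}
    (hA : ∀ b, (A b).IsUpperTriangular) : (diagBlocks A).IsUpperTriangular := by
  intro i j hij
  obtain ⟨⟨i, b⟩, rfl⟩ := (blockIndex m).surjective i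
  obtain ⟨⟨j, c⟩, rfl⟩ := (blockIndex m).surjective j
  rw [diagBlocks_apply]
  split_ifs with h
  · dsimp only at h
    subst h
    refine hA b ?_
    simp only [id, Fin.lt_def, blockIndex_val] at hij ⊢
    exact lt_of_add_lt_add_right hij
  · rfl

theorem skewTranspose_diagBlocks (A : Fin (m + m) → Matrix (Fin 15) (Fin 15) S) :
    skewTranspose (diagBlocks A) = diagBlocks fun b => skewTranspose (A b.rev) := by
  ext i j
  obtain ⟨⟨i, b⟩, rfl⟩ := (blockIndex m).surjective i
  obtain ⟨⟨j, c⟩, rfl⟩ := (blockIndex m).surjective j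
  rw [skewTranspose, Matrix.of_apply, blockIndex_rev, blockIndex_rev, diagBlocks_apply,
    diagBlocks_apply]
  by_cases h : b = c
  · simp [h, skewTranspose]
  · simp [h, Ne.symm h]

/-- The representation of `Baxt n` by block diagonal matrices. -/
def baxtHom {n : ℕ} (s : S) (e : Fin m ≃ PairIdx n) :
    Baxt n →* Matrix (Fin (30 * m)) (Fin (30 * m)) S where
  toFun x := diagBlocks fun b => baxt3Hom s (unfoldPairs e (pairsHom n x) b)
  map_one' := by
    rw [map_one, unfoldPairs_one, ← diagBlocks_one]
    exact congrArg diagBlocks (funext fun b => map_one _)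
  map_mul' x y := by
    rw [map_mul, unfoldPairs_mul, ← diagBlocks_mul]
    exact congrArg diagBlocks (funext fun b => map_mul _ _ _)

theorem baxtHom_apply {n : ℕ} (s : S) (e : Fin m ≃ PairIdx n) (x : Baxt n) :
    baxtHom s e x = diagBlocks fun b => baxt3Hom s (unfoldPairs e (pairsHom n x) b) :=
  rfl

/-- Skew transposition reverses the order of the blocks, and so does the involution on the unfolded
list. -/
theorem baxtHom_star {n : ℕ} (s : S) (e : Fin m ≃ PairIdx n) (x : Baxt n) :
    baxtHom s e (star x) = skewTranspose (baxtHom s e x) := by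
  have h : pairsHom n (star x) = fun p => swapSharp (pairsHom n x p) :=
    funext fun p => pairHom_star _ _ p.2 x
  simp only [baxtHom_apply, skewTranspose_diagBlocks, h, unfoldPairs_swapSharp, baxt3Hom_star]

theorem baxtHom_injective {n : ℕ} (hn : 2 ≤ n) {s : S} (hs : HasInfiniteMulOrder s)
    (e : Fin m ≃ PairIdx n) : Function.Injective (baxtHom s e) := by
  intro x y h
  refine pairsHom_injective hn (unfoldPairs_injective e (funext fun b => ?_))
  exact baxt3Hom_injective hs (congrFun (diagBlocks_injective h) b)

end Unfolding

/-- Such an element is a nonzero real `x`, and its `i`-th power is the real number `i * x`, from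
which `x` can be cancelled. -/
theorem MaxPlus.hasInfiniteMulOrder {a : MaxPlus} (h0 : a ≠ 0) (h1 : a ≠ 1) :
    HasInfiniteMulOrder a := by
  intro i j
  refine ⟨fun h => ?_, fun h => h ▸ rfl⟩
  obtain ⟨x, hx⟩ := WithTop.ne_top_iff_exists.mp
    (show Tropical.untrop a ≠ ⊤ from fun h => h0 (Tropical.untrop_injective h))
  obtain rfl : a = Tropical.trop (x : WithTop ℝᵒᵈ) := Tropical.untrop_injective hx.symm
  rw [← Tropical.trop_nsmul, ← Tropical.trop_nsmul, Tropical.trop_inj_iff, ← WithTop.coe_nsmul,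
    ← WithTop.coe_nsmul, WithTop.coe_inj] at h
  have hx0 : OrderDual.ofDual x ≠ 0 := fun h => h1 (by
    rw [show x = 0 from h]
    rfl)
  have h' : (i : ℝ) * OrderDual.ofDual x = j * OrderDual.ofDual x := by
    simpa using congrArg OrderDual.ofDual h
  exact_mod_cast mul_right_cancel₀ hx0 h'

end Baxter

theorem mainTheorem7 (n : ℕ) (hn : 4 ≤ n) :
    (∀ (S : Type*) [CommSemiring S] (_ : ∀ a : S, a + a = a) (s : S) (_ : HasInfiniteMulOrder s)
        (e : Fin (n.choose 2) ≃ PairIdx n),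
      ∃ (ϕ : Baxt n →* (PairIdx n → Baxt 3 × Baxt 3))
        (φ₃ : Baxt 3 →* Matrix (Fin 15) (Fin 15) S)
        (φ : Baxt n →* Matrix (Fin (30 * n.choose 2)) (Fin (30 * n.choose 2)) S),
        -- the embedding into a product of copies of `Baxt 3 × Baxt 3`
        (∀ (k : Fin n) (p : PairIdx n), ϕ (Baxt.mk [k]) p = pairLetter p.1.1 p.1.2 k) ∧
        (∀ (x : Baxt n) (p : PairIdx n), ϕ (star x) p = swapSharp (ϕ x p)) ∧
        Function.Injective ϕ ∧
        -- the representation of `Baxt 3`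
        (∀ a : Fin 3, φ₃ (Baxt.mk [a]) = baxt3Matrix s a) ∧
        (∀ x, (φ₃ x).IsUpperTriangular) ∧
        (∀ x, φ₃ (star x) = skewTranspose (φ₃ x)) ∧
        Function.Injective φ₃ ∧
        -- the representation of `Baxt n` built from them is faithful
        (∀ x, φ x = diagBlocks fun b => φ₃ (unfoldPairs e (ϕ x) b)) ∧
        (∀ x, (φ x).IsUpperTriangular) ∧
        (∀ x, φ (star x) = skewTranspose (φ x)) ∧
        Function.Injective φ) ∧
    -- the tropical semiring is an instance
    ((∀ a : MaxPlus, a + a = a) ∧ ∀ a : MaxPlus, a ≠ 0 → a ≠ 1 → HasInfiniteMulOrder a) := by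
  refine ⟨fun S _ _ s hs e => ⟨pairsHom n, baxt3Hom s, baxtHom s e,
    fun k p => pairHom_letter _ _ p.2 k, fun x p => pairHom_star _ _ p.2 x,
    pairsHom_injective (by lia), baxt3Hom_letter s, baxt3Hom_isUpperTriangular s,
    baxt3Hom_star s, baxt3Hom_injective hs, baxtHom_apply s e,
    fun x => diagBlocks_isUpperTriangular fun b => baxt3Hom_isUpperTriangular s _,
    baxtHom_star s e, baxtHom_injective (by lia) hs e⟩,
    Tropical.add_self, fun a h0 h1 => MaxPlus.hasInfiniteMulOrder h0 h1⟩
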